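/- **Setting.** Followers $1,\dots,N$ with $\dot x_i=Ax_i+Bu_i$ and a leader $\dot x_0=Ax_0$ ($x_i\in\mathbb R^n$, $u_i\in\mathbb R^p$, $A\ne0$). The followers communicate over a directed graph without self-loops on $\{1,\dots,N\}$; $N_i$ is the set of nodes from which $i$ receives information, $d_i=|N_i|$, $\mathcal L$ is the Laplacian (in-degree matrix minus adjacency matrix $[a_{ij}]$, $a_{ij}=1$ if $j\in N_i$ and $0$ otherwise), $g_i=1$ if $i$ observes the leader (is pinned) and $g_i=0$ otherwise, $G=\mathrm{diag}\{g_i\}$. The graph contains a spanning tree rooted at a pinned node. Norms are Euclidean, and the induced norms for matrices. Let $\Theta=\mathrm{diag}\{\vartheta_i\}$, $\vartheta_i>0$, be such that $H=\Theta^{-1}(\mathcal L+G)+(\mathcal L+G)'\Theta^{-1}>0$, and put $\alpha=\frac12\lambda_{\min}(H)$, $\vartheta_{\min}=\min_i\vartheta_i$, $\underline\vartheta=\min_i\vartheta_i^{-1}$, $P=\Theta^{-1}(\mathcal L+G)(\mathcal L+G)'\Theta^{-1}$. Let $R,Q,Y$ be symmetric positive definite with $$YA+A'Y-2\vartheta_{\min}YBR^{-1}B'Y+Q\le0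 ,$$ and let $\omega>0$, $\mu_i>0$ be such that $\rho_i=\alpha_1-\mu_i-\frac{\omega}{\alpha}\alpha_2>0$ for all $i$, where $\alpha_1=\frac{\lambda_{\min}(Q)}{\lambda_{\max}(Y)}$ and $\alpha_2=\frac{\lambda_{\max}(P)\lambda_{\max}^2(YBR^{-1}B'Y)}{\underline\vartheta\lambda_{\min}(Y)}$. Let $\rho_{\min}=\min_i\rho_i$, $\nu_i>0$, $\sigma_i\in(0,\rho_{\min})$, $\gamma>0$, $K=-\frac1\alpha R^{-1}B'Y$ and $\bar\eta=\max_i\big(\|A\|+(2d_i+g_i)\|BK\|\big)$. Let $z_i=\sum_{j\in N_i}(x_j-x_i)+g_i(x_0-x_i)$. Agent $i$ applies $u_i(t)=-K\hat z_i(t)$, where $\hat z_i(t)=z_i(t_k^i)$ for $t\in[t_k^i,t_{k+1}^i)$, and its event times are $t_0^i=0$ and $$t_{k+1}^i=\inf\big\{t>t_k^i:\ \|z_i(t_k^i)-z_i(t)\|^2\ge\alpha\omega\big(\mu_i\vartheta_i^{-1}z_i(t)'Yz_i(t)+\nu_ie^{-\sigma_it}+\gamma\big)\big\},\qquad \inf\emptyset=\infty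 .$$ **Statement.** For every run of this closed loop on $[0,\infty)$, the event times of each agent do not accumulate at a finite time, and for every $\delta>0$ there is a time $t_\delta$ such that, for every agent $i$ whose neighbours $j\in N_i$ all have infinite sequences of (finite) event times (in particular for every $i$, if all the event sequences are infinite), $$\inf_{k:\,t_k^i>t_\delta}(t_{k+1}^i-t_k^i)\ \ge\ \pi=\frac1{\|A\|}\ln\Big(1+\frac{\|A\|\sqrt{\alpha\omega\underline\vartheta\lambda_{\min}(Y)\rho_{\min}}}{\bar\eta(1+\delta)\sqrt N}\Big).$$ The bound $\pi$ does not depend on $\gamma$. -/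

import Mathlib

open Matrix Set

noncomputable section

namespace EventTriggered

/-- `ℝⁿ` with its Euclidean norm. -/
abbrev Vec (n : ℕ) : Type := EuclideanSpace ℝ (Fin n)

/-- Smallest eigenvalue of a real symmetric matrix (of positive size). -/
def lamMin {m : ℕ} (M : Matrix (Fin m) (Fin m) ℝ) : ℝ := sInf (spectrum ℝ M)

/-- Largest eigenvalue of a real symmetric matrix (of positive size). -/
def lamMax {m : ℕ} (M : Matrix (Fin m) (Fin m) ℝ) : ℝ := sSup (spectrum ℝ M)

/-- The norm of a matrix induced by the Euclidean norm. -/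
def matNorm {m : ℕ} (M : Matrix (Fin m) (Fin m) ℝ) : ℝ := ‖Matrix.toEuclideanCLM (𝕜 := ℝ) M‖

/-- `G` contains a spanning tree rooted at `r`: a subgraph `T` on all nodes in which `r` has no
parent, every other node has exactly one parent, and every node is reached from `r` by a directed
path. -/
def HasSpanningTreeRootedAt {V : Type*} (G : Digraph V) (r : V) : Prop :=
  ∃ T : Digraph V, (∀ j i, T.Adj j i → G.Adj j i) ∧ (∀ j, ¬ T.Adj j r) ∧
    (∀ i, i ≠ r → ∃! j, T.Adj j i) ∧ ∀ i, Relation.ReflTransGen T.Adj r i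

/-- The data of the multi-agent system with followers `Fin N`, state dimension `n` and input
dimension `p`, and of the control design, except for the parameters `ν i`, `σ i` and `γ` of the
triggering rule. -/
structure Design (N n p : ℕ) where
  /-- The graph of the followers: `graph.Adj j i` means that `i` obtains information from `j`. -/
  graph : Digraph (Fin N)
  /-- The followers that observe the leader. -/
  pinned : Set (Fin N)
  /-- The agents have the dynamics `ẋ = A x + B u`. -/
  A : Matrix (Fin n) (Fin n) ℝ
  B : Matrix (Fin n) (Fin p) ℝ
  R : Matrix (Fin p) (Fin p) ℝ
  Q : Matrix (Fin n) (Fin n) ℝ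
  Y : Matrix (Fin n) (Fin n) ℝ
  /-- The diagonal of `Θ`. -/
  θ : Fin N → ℝ
  ω : ℝ
  μ : Fin N → ℝ

namespace Design

variable {N n p : ℕ} (D : Design N n p)

open Classical in
/-- Adjacency matrix `𝒜 = [a i j]`. -/
def adj : Matrix (Fin N) (Fin N) ℝ := Matrix.of fun i j => if D.graph.Adj j i then 1 else 0

open Classical in
/-- Pinning gains. -/
def g (i : Fin N) : ℝ := if i ∈ D.pinned then 1 else 0

/-- In-degrees. -/
def deg (i : Fin N) : ℝ := ∑ j, D.adj i j

/-- `ℒ + G`, where `ℒ = 𝒟 - 𝒜` is the Laplacian matrix and `G = diag (g i)`. -/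
def LG : Matrix (Fin N) (Fin N) ℝ :=
  (Matrix.diagonal D.deg - D.adj) + Matrix.diagonal D.g

/-- `Θ⁻¹`. -/
def thetaInv : Matrix (Fin N) (Fin N) ℝ := Matrix.diagonal fun i => (D.θ i)⁻¹

/-- `H = Θ⁻¹ (ℒ + G) + (ℒ + G)' Θ⁻¹`. -/
def H : Matrix (Fin N) (Fin N) ℝ := D.thetaInv * D.LG + D.LGᵀ * D.thetaInv

/-- `P = Θ⁻¹ (ℒ + G) (ℒ + G)' Θ⁻¹`. -/
def P : Matrix (Fin N) (Fin N) ℝ := D.thetaInv * D.LG * D.LGᵀ * D.thetaInv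

def α : ℝ := 1 / 2 * lamMin D.H

/-- `ϑ_min = min ϑ i`. -/
def thetaMin : ℝ := ⨅ i, D.θ i

/-- `min (ϑ i)⁻¹`, the underlined `ϑ`. -/
def thetaUnder : ℝ := ⨅ i, (D.θ i)⁻¹

/-- `Y B R⁻¹ B' Y`. -/
def YBRBY : Matrix (Fin n) (Fin n) ℝ := D.Y * D.B * D.R⁻¹ * D.Bᵀ * D.Y

/-- The left-hand side of the Riccati inequality,
`Y A + A' Y - 2 ϑ_min Y B R⁻¹ B' Y + Q`. -/
def riccati : Matrix (Fin n) (Fin n) ℝ :=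
  D.Y * D.A + D.Aᵀ * D.Y - (2 * D.thetaMin) • D.YBRBY + D.Q

/-- The feedback gain `K = -(1/α) R⁻¹ B' Y`. -/
def K : Matrix (Fin p) (Fin n) ℝ := -((1 / D.α) • (D.R⁻¹ * D.Bᵀ * D.Y))

def α₁ : ℝ := lamMin D.Q / lamMax D.Y

def α₂ : ℝ := lamMax D.P * lamMax D.YBRBY ^ 2 / (D.thetaUnder * lamMin D.Y)

def ρ (i : Fin N) : ℝ := D.α₁ - D.μ i - D.ω / D.α * D.α₂

def ρmin : ℝ := ⨅ i, D.ρ i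

/-- `η̄ = max η i` with `η i = ‖A‖ + (2 d i + g i) ‖B K‖`. -/
def etaBar : ℝ := ⨆ i, (matNorm D.A + (2 * D.deg i + D.g i) * matNorm (D.B * D.K))

/-- The asymptotic lower bound `π` on the inter-event intervals. -/
def interEventBound (δ : ℝ) : ℝ :=
  1 / matNorm D.A *
    Real.log (1 + matNorm D.A * √(D.α * D.ω * D.thetaUnder * lamMin D.Y * D.ρmin) /
      (D.etaBar * (1 + δ) * √(N : ℝ)))

/-- The combinational state `z i` of agent `i` at time `τ`, for the leader trajectory `x₀` and the
follower trajectories `x`. -/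
def combState (x₀ : ℝ → Vec n) (x : Fin N → ℝ → Vec n) (i : Fin N) (τ : ℝ) : Vec n :=
  (∑ j, D.adj i j • (x j τ - x i τ)) + D.g i • (x₀ τ - x i τ)

/-- The triggering threshold `α ω (μ i (ϑ i)⁻¹ z' Y z + ν i e^{-σ i τ} + γ)` of agent `i`. -/
def threshold (ν σ : Fin N → ℝ) (γ : ℝ) (i : Fin N) (z : Vec n) (τ : ℝ) : ℝ :=
  D.α * D.ω * (D.μ i * (D.θ i)⁻¹ * inner ℝ z (Matrix.toEuclideanLin D.Y z)
    + ν i * Real.exp (-σ i * τ) + γ)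

/-- The trajectories `x₀`, `x` of the leader and the followers on `[0, ∞)` together with the event
times `t i 0 = 0 < t i 1 < ⋯` of every agent `i` and the held measurement signals `zhat i` are a
run of the closed loop with event-triggered control. An event time is `⊤` if the triggering
condition is not met any more (`inf ∅ = ∞`). The control inputs are piecewise constant and
continuous from the right, so the followers' equations are stated for continuous trajectories and
right derivatives. No assumption is made on the accumulation of event times; `zhat i` is
unconstrained after an accumulation point of the event times of agent `i`, if there is one. -/
structure IsClosedLoop (ν σ : Fin N → ℝ) (γ : ℝ) (x₀ : ℝ → Vec n) (x : Fin N → ℝ → Vec n)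
    (t : Fin N → ℕ → EReal) (zhat : Fin N → ℝ → Vec n) : Prop where
  leader : ∀ τ, 0 ≤ τ → HasDerivWithinAt x₀ (Matrix.toEuclideanLin D.A (x₀ τ)) (Ici 0) τ
  continuousOn : ∀ i, ContinuousOn (x i) (Ici 0)
  /-- `ẋ i = A x i + B u i` with `u i = -K zhat i`. -/
  follower : ∀ i τ, 0 ≤ τ → HasDerivWithinAt (x i)
    (Matrix.toEuclideanLin D.A (x i τ)
      + Matrix.toEuclideanLin D.B (-(Matrix.toEuclideanLin D.K (zhat i τ)))) (Ici τ) τ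
  /-- The measurement is held constant between events. -/
  held : ∀ i k (τ : ℝ), t i k ≤ (τ : EReal) → (τ : EReal) < t i (k + 1) →
    zhat i τ = D.combState x₀ x i (t i k).toReal
  first_event : ∀ i, t i 0 = 0
  /-- The next event occurs at the first time after the last event at which the deviation of the
  last sample from the combinational state, squared, reaches the threshold. -/
  next_event : ∀ i k, t i (k + 1) = sInf ((fun τ : ℝ => (τ : EReal)) ''
    {τ : ℝ | t i k < (τ : EReal) ∧
      D.threshold ν σ γ i (D.combState x₀ x i τ) τ ≤
        ‖D.combState x₀ x i (t i k).toReal - D.combState x₀ x i τ‖ ^ 2})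

end Design

end EventTriggered

end

/-! Put `W = Θ⁻¹(ℒ+G)`, so that `H = W + W'` and `P = W W'`, and let `V = ∑ ϑ_i⁻¹ z_i' Y z_i`. The
argument has three ingredients.

No accumulation: the threshold is at least `αωγ`, so consecutive samples of one agent differ by at
least `√(αωγ)`. At an accumulation point of events, continuity of `z_i` would make these differences
tend to zero (`exists_lt_event`). Hence every time lies between two events and the triggering
inequality holds at all times.

Dissipation: the Riccati inequality handles the drift, `H` gives the coupling enough strength to
cancel `Y B R⁻¹ B' Y`, and Young's inequality with weight `ω` together with the triggering rule
absorbs the sampling errors. This gives `V' ≤ -ρ_min V + ∑ (ν_i e^{-σ_i t} + γ)`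
(`lyap_dissipation`). By Grönwall, `V` eventually falls below any level above `Nγ/ρ_min`, so every
`‖z_i‖` is eventually at most `r = (1+δ)√(Nγ/E)` with `E = ϑ̲ λ_min(Y) ρ_min`.

Interval length: once the held samples of agent `i` and its neighbours are bounded by `r`, the
deviation grows from zero at rate at most `‖A‖‖s‖ + η_i r`, and it must reach `√(αωγ)`. Both `r` and
this target scale as `√γ`, so `γ` cancels. Infinite event sequences of the neighbours ensure that
their held samples are recent enough to obey the bound `r`. -/

noncomputable section

namespace EventTriggered

/-! ### Rayleigh bounds and quadratic forms of symmetric matrices -/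

section Spectral

variable {m : ℕ} {M : Matrix (Fin m) (Fin m) ℝ}

lemma spectrum_finite (hM : M.IsHermitian) : (spectrum ℝ M).Finite := by
  rw [hM.spectrum_real_eq_range_eigenvalues]
  exact Set.finite_range _

lemma posSemidef_of_spectrum_nonneg (hM : M.IsHermitian) (h : ∀ a ∈ spectrum ℝ M, 0 ≤ a) :
    M.PosSemidef := by
  rw [hM.posSemidef_iff_eigenvalues_nonneg]
  intro i
  exact h _ (by rw [hM.spectrum_real_eq_range_eigenvalues]; exact ⟨i, rfl⟩)

lemma inner_nonneg_of_posSemidef (hM : M.PosSemidef) (v : Vec m) :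
    0 ≤ inner ℝ v (Matrix.toEuclideanLin M v) := by
  have := hM.dotProduct_mulVec_nonneg v.ofLp
  rw [EuclideanSpace.inner_eq_star_dotProduct, dotProduct_comm]
  simpa using this

lemma lamMin_mul_le_inner (hM : M.IsHermitian) (v : Vec m) :
    lamMin M * ‖v‖ ^ 2 ≤ inner ℝ v (Matrix.toEuclideanLin M v) := by
  have hp : (M - algebraMap ℝ _ (lamMin M)).PosSemidef := by
    refine posSemidef_of_spectrum_nonneg ?_ ?_
    · refine hM.sub ?_
      rw [Matrix.algebraMap_eq_diagonal]
      exact Matrix.isHermitian_diagonal _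
    · intro a ha
      rw [← spectrum.sub_singleton_eq] at ha
      obtain ⟨b, hb, c, hc, rfl⟩ := ha
      rw [Set.mem_singleton_iff] at hc
      subst hc
      have := csInf_le (spectrum_finite hM).bddBelow hb
      simpa [lamMin] using this
  have := inner_nonneg_of_posSemidef hp v
  rw [Algebra.algebraMap_eq_smul_one, map_sub, map_smul, Matrix.toLpLin_one, LinearMap.sub_apply,
    inner_sub_right, LinearMap.smul_apply, LinearMap.id_apply, inner_smul_right,
    real_inner_self_eq_norm_sq] at this
  linarith

lemma inner_le_lamMax_mul (hM : M.IsHermitian) (v : Vec m) :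
    inner ℝ v (Matrix.toEuclideanLin M v) ≤ lamMax M * ‖v‖ ^ 2 := by
  have h := lamMin_mul_le_inner hM.neg v
  have : lamMin (-M) = - lamMax M := by
    rw [lamMin, lamMax, ← spectrum.neg_eq, Real.sInf_neg]
  rw [this, map_neg, LinearMap.neg_apply, inner_neg_right] at h
  linarith

lemma spectrum_nonempty (hm : 0 < m) (hM : M.IsHermitian) : (spectrum ℝ M).Nonempty := by
  have : Nonempty (Fin m) := ⟨⟨0, hm⟩⟩
  rw [hM.spectrum_real_eq_range_eigenvalues]
  exact Set.range_nonempty _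

lemma lamMin_pos (hm : 0 < m) (hM : M.PosDef) : 0 < lamMin M := by
  have h := (spectrum_nonempty hm hM.1).csInf_mem (spectrum_finite hM.1)
  rw [hM.1.spectrum_real_eq_range_eigenvalues] at h
  obtain ⟨i, hi⟩ := h
  rw [lamMin, hM.1.spectrum_real_eq_range_eigenvalues, ← hi]
  exact hM.eigenvalues_pos i

lemma lamMin_le_lamMax (hm : 0 < m) (hM : M.IsHermitian) : lamMin M ≤ lamMax M := by
  obtain ⟨a, ha⟩ := spectrum_nonempty hm hM
  exact (csInf_le (spectrum_finite hM).bddBelow ha).trans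
    (le_csSup (spectrum_finite hM).bddAbove ha)

lemma lamMax_nonneg (hM : M.PosSemidef) : 0 ≤ lamMax M := by
  refine Real.sSup_nonneg fun a ha => ?_
  rw [hM.1.spectrum_real_eq_range_eigenvalues] at ha
  obtain ⟨i, rfl⟩ := ha
  exact hM.eigenvalues_nonneg i

lemma inner_toEuclideanLin_transpose {k l : ℕ} (C : Matrix (Fin k) (Fin l) ℝ) (u : Vec l)
    (v : Vec k) :
    inner ℝ u (Matrix.toEuclideanLin Cᵀ v) = inner ℝ (Matrix.toEuclideanLin C u) v := by
  rw [← Matrix.conjTranspose_eq_transpose_of_trivial, Matrix.toEuclideanLin_conjTranspose_eq_adjoint,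
    LinearMap.adjoint_inner_right]

open scoped MatrixOrder Matrix.Norms.L2Operator in
lemma exists_factor (hM : M.PosSemidef) : ∃ C : Matrix (Fin m) (Fin m) ℝ,
    ∀ u v : Vec m, inner ℝ u (Matrix.toEuclideanLin M v) =
      inner ℝ (Matrix.toEuclideanLin C u) (Matrix.toEuclideanLin C v) := by
  obtain ⟨C, rfl⟩ := CStarAlgebra.nonneg_iff_eq_star_mul_self.mp hM.nonneg
  refine ⟨C, fun u v => ?_⟩
  rw [Matrix.star_eq_conjTranspose, Matrix.toLpLin_mul_same, LinearMap.comp_apply,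
    Matrix.conjTranspose_eq_transpose_of_trivial, inner_toEuclideanLin_transpose]

/-- With `M = C'C` and `w = Mv`, Cauchy–Schwarz gives `‖w‖² = ⟨Cw, Cv⟩ ≤ ‖Cw‖‖Cv‖`, and the Rayleigh
bound controls both factors. -/
lemma norm_toEuclideanLin_sq_le (hM : M.PosSemidef) (v : Vec m) :
    ‖Matrix.toEuclideanLin M v‖ ^ 2 ≤ lamMax M ^ 2 * ‖v‖ ^ 2 := by
  obtain ⟨C, hC⟩ := exists_factor hM
  set w := Matrix.toEuclideanLin M v with hw
  have hl := lamMax_nonneg hM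
  have key : ∀ u, ‖Matrix.toEuclideanLin C u‖ ^ 2 ≤ lamMax M * ‖u‖ ^ 2 := fun u => by
    rw [← real_inner_self_eq_norm_sq, ← hC]
    exact inner_le_lamMax_mul hM.1 u
  have h1 : ‖w‖ ^ 2 ≤ ‖Matrix.toEuclideanLin C w‖ * ‖Matrix.toEuclideanLin C v‖ := by
    rw [← real_inner_self_eq_norm_sq]
    conv_lhs => rw [hw, hC w v]
    exact real_inner_le_norm _ _
  have h2 : (‖w‖ ^ 2) ^ 2 ≤ (lamMax M * ‖w‖ ^ 2) * (lamMax M * ‖v‖ ^ 2) := by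
    calc (‖w‖ ^ 2) ^ 2 ≤ (‖Matrix.toEuclideanLin C w‖ * ‖Matrix.toEuclideanLin C v‖) ^ 2 := by
          gcongr
      _ = ‖Matrix.toEuclideanLin C w‖ ^ 2 * ‖Matrix.toEuclideanLin C v‖ ^ 2 := by ring
      _ ≤ _ := mul_le_mul (key w) (key v) (by positivity) (by positivity)
  rcases eq_or_lt_of_le (sq_nonneg ‖w‖) with h0 | h0
  · rw [← h0]; positivity
  · refine le_of_mul_le_mul_left ?_ h0
    nlinarith

lemma norm_toEuclideanLin_le (M : Matrix (Fin m) (Fin m) ℝ) (v : Vec m) :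
    ‖Matrix.toEuclideanLin M v‖ ≤ matNorm M * ‖v‖ :=
  (Matrix.toEuclideanCLM (𝕜 := ℝ) M).le_opNorm v

lemma matNorm_pos (hM : M ≠ 0) : 0 < matNorm M := by
  rw [matNorm, norm_pos_iff]
  simpa using hM

lemma matNorm_nonneg (M : Matrix (Fin m) (Fin m) ℝ) : 0 ≤ matNorm M := norm_nonneg _

/-- The quadratic form of `M ⊗ I`, expanded along coordinates. -/
lemma sum_sum_mul_inner_eq {n : ℕ} (M : Matrix (Fin m) (Fin m) ℝ) (w : Fin m → Vec n) :
    ∑ i, ∑ j, M i j * inner ℝ (w i) (w j) =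
      ∑ l, inner ℝ (WithLp.toLp 2 fun i => w i l)
        (Matrix.toEuclideanLin M (WithLp.toLp 2 fun i => w i l)) := by
  simp only [PiLp.inner_apply, Matrix.toLpLin_apply, Matrix.mulVec, dotProduct, Finset.mul_sum,
    RCLike.inner_apply, conj_trivial]
  simp only [Finset.sum_mul]
  refine (Finset.sum_congr rfl fun i _ => Finset.sum_comm).trans ?_
  rw [Finset.sum_comm]
  refine Finset.sum_congr rfl fun l _ => Finset.sum_congr rfl fun i _ =>
    Finset.sum_congr rfl fun j _ => ?_
  ring

lemma sum_norm_sq_eq {n : ℕ} (w : Fin m → Vec n) :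
    ∑ i, ‖w i‖ ^ 2 = ∑ l, ‖(WithLp.toLp 2 fun i => w i l : Vec m)‖ ^ 2 := by
  simp only [EuclideanSpace.norm_sq_eq]
  exact Finset.sum_comm

lemma lamMin_mul_le_sum {n : ℕ} (hM : M.IsHermitian) (w : Fin m → Vec n) :
    lamMin M * ∑ i, ‖w i‖ ^ 2 ≤ ∑ i, ∑ j, M i j * inner ℝ (w i) (w j) := by
  rw [sum_sum_mul_inner_eq, sum_norm_sq_eq, Finset.mul_sum]
  exact Finset.sum_le_sum fun l _ => lamMin_mul_le_inner hM _

lemma sum_le_lamMax_mul {n : ℕ} (hM : M.IsHermitian) (w : Fin m → Vec n) :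
    ∑ i, ∑ j, M i j * inner ℝ (w i) (w j) ≤ lamMax M * ∑ i, ‖w i‖ ^ 2 := by
  rw [sum_sum_mul_inner_eq, sum_norm_sq_eq, Finset.mul_sum]
  exact Finset.sum_le_sum fun l _ => inner_le_lamMax_mul hM _

end Spectral

end EventTriggered

/-! ### Dissipation inequality for the Lyapunov function -/

namespace EventTriggered
namespace Design

variable {N n p : ℕ} (D : Design N n p)

lemma g_nonneg (i : Fin N) : 0 ≤ D.g i := by
  unfold g; split_ifs <;> norm_num

lemma adj_nonneg (i j : Fin N) : 0 ≤ D.adj i j := by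
  unfold adj; simp only [Matrix.of_apply]; split_ifs <;> norm_num

lemma adj_eq_zero {i j : Fin N} (h : ¬ D.graph.Adj j i) : D.adj i j = 0 := by
  simp [adj, h]

lemma deg_nonneg (i : Fin N) : 0 ≤ D.deg i := Finset.sum_nonneg fun j _ => D.adj_nonneg i j

lemma YBRBY_posSemidef (hR : D.R.PosDef) (hY : D.Y.PosDef) : D.YBRBY.PosSemidef := by
  have h := hR.inv.posSemidef.conjTranspose_mul_mul_same (D.Bᵀ * D.Y)
  rw [Matrix.conjTranspose_mul, hY.1.eq, Matrix.conjTranspose_eq_transpose_of_trivial,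
    Matrix.transpose_transpose] at h
  simpa only [YBRBY, Matrix.mul_assoc] using h

lemma Y_mul_BK : D.Y * (D.B * D.K) = -((1 / D.α) • D.YBRBY) := by
  simp only [K, YBRBY, Matrix.mul_neg, Matrix.mul_smul, Matrix.mul_assoc]

lemma P_eq : D.P = (D.thetaInv * D.LG) * (D.thetaInv * D.LG)ᵀ := by
  rw [P, Matrix.transpose_mul, thetaInv, Matrix.diagonal_transpose]
  simp only [Matrix.mul_assoc]

lemma H_eq : D.H = (D.thetaInv * D.LG) + (D.thetaInv * D.LG)ᵀ := by
  rw [H, Matrix.transpose_mul, thetaInv, Matrix.diagonal_transpose]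

lemma P_posSemidef : D.P.PosSemidef := by
  rw [P_eq, ← Matrix.conjTranspose_eq_transpose_of_trivial]
  exact Matrix.posSemidef_self_mul_conjTranspose _

lemma α_pos (hN : 0 < N) (hH : D.H.PosDef) : 0 < D.α := by
  have := lamMin_pos hN hH
  unfold α; positivity

lemma thetaMin_le (i : Fin N) : D.thetaMin ≤ D.θ i := ciInf_le (Set.finite_range _).bddBelow i

lemma thetaUnder_le (i : Fin N) : D.thetaUnder ≤ (D.θ i)⁻¹ :=
  ciInf_le (Set.finite_range fun i => (D.θ i)⁻¹).bddBelow i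

lemma ρmin_le (i : Fin N) : D.ρmin ≤ D.ρ i := ciInf_le (Set.finite_range D.ρ).bddBelow i

lemma ciInf_fin_pos (hN : 0 < N) {f : Fin N → ℝ} (hf : ∀ i, 0 < f i) : 0 < ⨅ i, f i := by
  have : Nonempty (Fin N) := ⟨⟨0, hN⟩⟩
  obtain ⟨i, hi⟩ := exists_eq_ciInf_of_finite (f := f)
  rw [← hi]; exact hf i

lemma thetaUnder_pos (hN : 0 < N) (hθ : ∀ i, 0 < D.θ i) : 0 < D.thetaUnder :=
  ciInf_fin_pos hN fun i => inv_pos.2 (hθ i)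

lemma ρmin_pos (hN : 0 < N) (hρ : ∀ i, 0 < D.ρ i) : 0 < D.ρmin := ciInf_fin_pos hN hρ

/-- The Lyapunov function `z' (Θ⁻¹ ⊗ Y) z`. -/
def lyap (z : Fin N → Vec n) : ℝ :=
  ∑ i, (D.θ i)⁻¹ * inner ℝ (z i) (Matrix.toEuclideanLin D.Y (z i))

lemma sum_norm_sq_le_lyap (hn : 0 < n) (hθ : ∀ i, 0 < D.θ i) (hY : D.Y.PosDef)
    (z : Fin N → Vec n) :
    D.thetaUnder * lamMin D.Y * ∑ i, ‖z i‖ ^ 2 ≤ D.lyap z := by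
  rw [Finset.mul_sum]
  refine Finset.sum_le_sum fun i _ => ?_
  have := lamMin_pos hn hY
  rw [mul_assoc]
  have h := lamMin_mul_le_inner hY.1 (z i)
  have h2 := inv_pos.2 (hθ i)
  exact (mul_le_mul_of_nonneg_right (D.thetaUnder_le i) (by positivity)).trans
    (mul_le_mul_of_nonneg_left h h2.le)

lemma riccati_inner_le (hY : D.Y.PosDef) (hriccati : (-D.riccati).PosSemidef) (v : Vec n) :
    2 * inner ℝ v (Matrix.toEuclideanLin D.Y (Matrix.toEuclideanLin D.A v)) ≤
      2 * D.thetaMin * inner ℝ v (Matrix.toEuclideanLin D.YBRBY v)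
        - inner ℝ v (Matrix.toEuclideanLin D.Q v) := by
  have h := inner_nonneg_of_posSemidef hriccati v
  have hYt : D.Yᵀ = D.Y := by
    rw [← Matrix.conjTranspose_eq_transpose_of_trivial]; exact hY.1.eq
  have h2 : inner ℝ v (Matrix.toEuclideanLin D.Aᵀ (Matrix.toEuclideanLin D.Y v)) =
      inner ℝ v (Matrix.toEuclideanLin D.Y (Matrix.toEuclideanLin D.A v)) := by
    rw [inner_toEuclideanLin_transpose, real_inner_comm]
    conv_rhs => rw [← hYt, inner_toEuclideanLin_transpose]
  rw [riccati] at h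
  simp only [map_neg, map_add, map_sub, map_smul, Matrix.toLpLin_mul_same, LinearMap.neg_apply,
    LinearMap.add_apply, LinearMap.sub_apply, LinearMap.smul_apply, LinearMap.comp_apply,
    inner_neg_right, inner_add_right, inner_sub_right, inner_smul_right, h2] at h
  linarith

/-- The quadratic form of the coupling term dominates that of `Y B R⁻¹ B' Y`. -/
lemma coupling_inner_ge (hR : D.R.PosDef) (hH : D.H.PosDef) (hY : D.Y.PosDef)
    (z : Fin N → Vec n) :
    D.α * ∑ i, inner ℝ (z i) (Matrix.toEuclideanLin D.YBRBY (z i)) ≤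
      ∑ i, ∑ j, (D.thetaInv * D.LG) i j *
        inner ℝ (z i) (Matrix.toEuclideanLin D.YBRBY (z j)) := by
  -- Factoring `Y B R⁻¹ B' Y = C'C` turns the coupling into the form of `W ⊗ I` at the vectors `C
  -- z_i`, whose symmetric part is `H/2`.
  obtain ⟨C, hC⟩ := exists_factor (D.YBRBY_posSemidef hR hY)
  have h := lamMin_mul_le_sum hH.1 (fun i => Matrix.toEuclideanLin C (z i))
  simp only [hC, real_inner_self_eq_norm_sq]
  rw [D.H_eq] at h
  simp only [Matrix.add_apply, Matrix.transpose_apply, add_mul, Finset.sum_add_distrib] at h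
  rw [Finset.sum_comm (f := fun i j => (D.thetaInv * D.LG) j i * _)] at h
  simp only [fun i j => real_inner_comm (Matrix.toEuclideanLin C (z i))
    (Matrix.toEuclideanLin C (z j))] at h
  rw [← D.H_eq] at h
  unfold α
  linarith

/-- The influence of the measurement errors `s`. -/
lemma coupling_error_le (hN : 0 < N) (hR : D.R.PosDef) (hH : D.H.PosDef) (hY : D.Y.PosDef)
    (hω : 0 < D.ω) (z s : Fin N → Vec n) :
    -(2 / D.α) * ∑ i, ∑ j, (D.thetaInv * D.LG) i j *
        inner ℝ (z i) (Matrix.toEuclideanLin D.YBRBY (s j)) ≤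
      D.ω / D.α * (lamMax D.P * lamMax D.YBRBY ^ 2 * ∑ i, ‖z i‖ ^ 2)
        + 1 / (D.α * D.ω) * ∑ i, ‖s i‖ ^ 2 := by
  have hα := D.α_pos hN hH
  have hM := D.YBRBY_posSemidef hR hY
  have hMt : D.YBRBYᵀ = D.YBRBY := by
    rw [← Matrix.conjTranspose_eq_transpose_of_trivial]; exact hM.1.eq
  set W := D.thetaInv * D.LG with hW
  set y : Fin N → Vec n := fun i => Matrix.toEuclideanLin D.YBRBY (z i) with hy
  have h1 : ∑ i, ∑ j, W i j * inner ℝ (z i) (Matrix.toEuclideanLin D.YBRBY (s j)) =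
      ∑ j, inner ℝ (∑ i, W i j • y i) (s j) := by
    rw [Finset.sum_comm]
    refine Finset.sum_congr rfl fun j _ => ?_
    rw [sum_inner]
    refine Finset.sum_congr rfl fun i _ => ?_
    rw [real_inner_smul_left, hy]
    conv_lhs => rw [← hMt, inner_toEuclideanLin_transpose]
  have h2 : ∑ j, ‖∑ i, W i j • y i‖ ^ 2 = ∑ i, ∑ k, D.P i k * inner ℝ (y i) (y k) := by
    simp only [← real_inner_self_eq_norm_sq, sum_inner, inner_sum, real_inner_smul_left,
      real_inner_smul_right, P_eq, ← hW, Matrix.mul_apply, Matrix.transpose_apply, Finset.sum_mul]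
    rw [Finset.sum_comm]
    refine Finset.sum_congr rfl fun i _ => ?_
    rw [Finset.sum_comm]
    refine Finset.sum_congr rfl fun k _ => Finset.sum_congr rfl fun j _ => ?_
    rw [real_inner_comm]
    ring
  have h3 : ∑ j, ‖∑ i, W i j • y i‖ ^ 2 ≤ lamMax D.P * lamMax D.YBRBY ^ 2 * ∑ i, ‖z i‖ ^ 2 := by
    rw [h2]
    refine (sum_le_lamMax_mul D.P_posSemidef.1 y).trans ?_
    rw [mul_assoc]
    refine mul_le_mul_of_nonneg_left ?_ (lamMax_nonneg D.P_posSemidef)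
    rw [Finset.mul_sum]
    exact Finset.sum_le_sum fun i _ => norm_toEuclideanLin_sq_le hM (z i)
  -- Young's inequality: with `q = ∑ i, W i j • y i`, expand `‖ω q + s_j‖² ≥ 0` and divide by `αω`.
  have h4 : ∀ j, -(2 / D.α) * inner ℝ (∑ i, W i j • y i) (s j) ≤
      D.ω / D.α * ‖∑ i, W i j • y i‖ ^ 2 + 1 / (D.α * D.ω) * ‖s j‖ ^ 2 := by
    intro j
    have h5 := norm_add_sq_real (D.ω • ∑ i, W i j • y i) (s j)
    have h6 := sq_nonneg ‖(D.ω • ∑ i, W i j • y i) + s j‖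
    rw [h5, norm_smul, real_inner_smul_left, Real.norm_of_nonneg hω.le] at h6
    have h7 : D.ω / D.α * ‖∑ i, W i j • y i‖ ^ 2 + 1 / (D.α * D.ω) * ‖s j‖ ^ 2
        - -(2 / D.α) * inner ℝ (∑ i, W i j • y i) (s j) = 1 / (D.α * D.ω) *
        ((D.ω * ‖∑ i, W i j • y i‖) ^ 2 + 2 * (D.ω * inner ℝ (∑ i, W i j • y i) (s j))
          + ‖s j‖ ^ 2) := by
      field_simp
      ring
    have h8 := mul_nonneg (by positivity : 0 ≤ 1 / (D.α * D.ω)) h6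
    linarith
  rw [h1, Finset.mul_sum]
  refine (Finset.sum_le_sum fun j _ => h4 j).trans ?_
  rw [Finset.sum_add_distrib, ← Finset.mul_sum, ← Finset.mul_sum]
  gcongr

/-- The right derivative of the combinational state of agent `i`. -/
def combDeriv (z zhat : Fin N → Vec n) (i : Fin N) : Vec n :=
  Matrix.toEuclideanLin D.A (z i)
    + Matrix.toEuclideanLin (D.B * D.K) (∑ j, D.LG i j • zhat j)

lemma inner_Y_combDeriv (z s : Fin N → Vec n) (i : Fin N) :
    inner ℝ (z i) (Matrix.toEuclideanLin D.Y (D.combDeriv z (fun j => z j + s j) i)) =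
      inner ℝ (z i) (Matrix.toEuclideanLin D.Y (Matrix.toEuclideanLin D.A (z i)))
      - 1 / D.α * (∑ j, D.LG i j * inner ℝ (z i) (Matrix.toEuclideanLin D.YBRBY (z j))
        + ∑ j, D.LG i j * inner ℝ (z i) (Matrix.toEuclideanLin D.YBRBY (s j))) := by
  have h : ∀ v, Matrix.toEuclideanLin D.Y (Matrix.toEuclideanLin (D.B * D.K) v) =
      -((1 / D.α) • Matrix.toEuclideanLin D.YBRBY v) := fun v => by
    rw [← LinearMap.comp_apply, ← Matrix.toLpLin_mul_same, Y_mul_BK]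
    simp
  rw [combDeriv, map_add, h, map_sum, inner_add_right, inner_neg_right, inner_smul_right,
    inner_sum, ← Finset.sum_add_distrib, sub_eq_add_neg]
  congr 3
  refine Finset.sum_congr rfl fun j _ => ?_
  rw [map_smul, inner_smul_right, map_add, inner_add_right, mul_add]

lemma inner_Y_comm (hY : D.Y.PosDef) (u v : Vec n) :
    inner ℝ u (Matrix.toEuclideanLin D.Y v) = inner ℝ v (Matrix.toEuclideanLin D.Y u) := by
  have hYt : D.Yᵀ = D.Y := by
    rw [← Matrix.conjTranspose_eq_transpose_of_trivial]; exact hY.1.eq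
  conv_lhs => rw [← hYt, inner_toEuclideanLin_transpose]
  exact real_inner_comm _ _

/-- The left side is the derivative of `V` when the held samples are `z + s`. The gain `1/α` makes
the coupling cancel the `Y B R⁻¹ B' Y` term of the drift; what remains is the sum of the three
contributions `-α₁`, `μ_i` and `(ω/α) α₂` making up `-ρ_i`. -/
lemma lyap_dissipation (hN : 0 < N) (hn : 0 < n) (hθ : ∀ i, 0 < D.θ i) (hH : D.H.PosDef)
    (hR : D.R.PosDef) (hQ : D.Q.PosDef) (hY : D.Y.PosDef) (hriccati : (-D.riccati).PosSemidef)
    (hω : 0 < D.ω) (z s : Fin N → Vec n) (c : Fin N → ℝ)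
    (hs : ∀ i, ‖s i‖ ^ 2 ≤ D.α * D.ω * (D.μ i * (D.θ i)⁻¹ *
      inner ℝ (z i) (Matrix.toEuclideanLin D.Y (z i)) + c i)) :
    ∑ i, (D.θ i)⁻¹ * (2 * inner ℝ (z i)
      (Matrix.toEuclideanLin D.Y (D.combDeriv z (fun j => z j + s j) i))) ≤
      -D.ρmin * D.lyap z + ∑ i, c i := by
  have hα := D.α_pos hN hH
  have hM := D.YBRBY_posSemidef hR hY
  have hlY := lamMin_pos hn hY
  have hlY' := hlY.trans_le (lamMin_le_lamMax hn hY.1)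
  have hθu := D.thetaUnder_pos hN hθ
  have hW : ∀ i j, (D.thetaInv * D.LG) i j = (D.θ i)⁻¹ * D.LG i j := fun i j => by
    rw [thetaInv, Matrix.diagonal_mul]
  have h1 := D.coupling_inner_ge hR hH hY z
  have h2 := D.coupling_error_le hN hR hH hY hω z s
  have h3 : ∀ i, (D.θ i)⁻¹ * (2 * inner ℝ (z i)
      (Matrix.toEuclideanLin D.Y (Matrix.toEuclideanLin D.A (z i)))) ≤
      2 * inner ℝ (z i) (Matrix.toEuclideanLin D.YBRBY (z i))
      - D.α₁ * ((D.θ i)⁻¹ * inner ℝ (z i) (Matrix.toEuclideanLin D.Y (z i))) := by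
    intro i
    have hi := inv_pos.2 (hθ i)
    have ha := mul_le_mul_of_nonneg_left (D.riccati_inner_le hY hriccati (z i)) hi.le
    -- This is why `ϑ_min` stands in the Riccati inequality: after weighting by `ϑ_i⁻¹` its
    -- quadratic term has coefficient at most 2, uniformly in `i`.
    have hb : (D.θ i)⁻¹ * D.thetaMin ≤ 1 := by
      rw [inv_mul_le_iff₀ (hθ i), mul_one]; exact D.thetaMin_le i
    have hc := mul_le_mul_of_nonneg_right hb (inner_nonneg_of_posSemidef hM (z i))
    have hd : D.α₁ * inner ℝ (z i) (Matrix.toEuclideanLin D.Y (z i)) ≤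
        inner ℝ (z i) (Matrix.toEuclideanLin D.Q (z i)) := by
      refine le_trans ?_ (lamMin_mul_le_inner hQ.1 (z i))
      have := inner_le_lamMax_mul hY.1 (z i)
      rw [α₁, div_mul_eq_mul_div, div_le_iff₀ hlY', mul_assoc]
      refine mul_le_mul_of_nonneg_left ?_ (lamMin_pos hn hQ).le
      linarith
    have he := mul_le_mul_of_nonneg_left hd hi.le
    linarith
  have h4 : lamMax D.P * lamMax D.YBRBY ^ 2 * ∑ i, ‖z i‖ ^ 2 ≤ D.α₂ * D.lyap z := by
    rw [α₂, div_mul_eq_mul_div, le_div_iff₀ (by positivity), mul_assoc]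
    refine mul_le_mul_of_nonneg_left ?_
      (mul_nonneg (lamMax_nonneg D.P_posSemidef) (sq_nonneg _))
    have := D.sum_norm_sq_le_lyap hn hθ hY z
    linarith
  have h5 : 1 / (D.α * D.ω) * ∑ i, ‖s i‖ ^ 2 ≤ ∑ i, (D.μ i * ((D.θ i)⁻¹ *
      inner ℝ (z i) (Matrix.toEuclideanLin D.Y (z i))) + c i) := by
    rw [Finset.mul_sum]
    refine Finset.sum_le_sum fun i _ => ?_
    rw [one_div_mul_eq_div, div_le_iff₀ (by positivity)]
    linarith [hs i]
  have h6 : ∑ i, (D.θ i)⁻¹ * (2 * inner ℝ (z i)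
      (Matrix.toEuclideanLin D.Y (D.combDeriv z (fun j => z j + s j) i))) =
      ∑ i, (D.θ i)⁻¹ * (2 * inner ℝ (z i)
        (Matrix.toEuclideanLin D.Y (Matrix.toEuclideanLin D.A (z i))))
      - 2 / D.α * ∑ i, ∑ j, (D.thetaInv * D.LG) i j *
        inner ℝ (z i) (Matrix.toEuclideanLin D.YBRBY (z j))
      + -(2 / D.α) * ∑ i, ∑ j, (D.thetaInv * D.LG) i j *
        inner ℝ (z i) (Matrix.toEuclideanLin D.YBRBY (s j)) := by
    rw [Finset.mul_sum, Finset.mul_sum, ← Finset.sum_sub_distrib, ← Finset.sum_add_distrib]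
    refine Finset.sum_congr rfl fun i _ => ?_
    simp only [hW, inner_Y_combDeriv, mul_assoc, ← Finset.mul_sum]
    ring
  have h7 := Finset.sum_le_sum fun i (_ : i ∈ Finset.univ) => h3 i
  have h8 : 2 * ∑ i, inner ℝ (z i) (Matrix.toEuclideanLin D.YBRBY (z i)) ≤
      2 / D.α * ∑ i, ∑ j, (D.thetaInv * D.LG) i j *
        inner ℝ (z i) (Matrix.toEuclideanLin D.YBRBY (z j)) := by
    have := mul_le_mul_of_nonneg_left h1 (by positivity : 0 ≤ 2 / D.α)
    rwa [← mul_assoc, div_mul_cancel₀ _ hα.ne'] at this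
  have h9 := mul_le_mul_of_nonneg_left h4 (by positivity : 0 ≤ D.ω / D.α)
  have h10 : ∑ i, (D.μ i * ((D.θ i)⁻¹ * inner ℝ (z i) (Matrix.toEuclideanLin D.Y (z i))) + c i)
      ≤ (D.α₁ - D.ω / D.α * D.α₂ - D.ρmin) * D.lyap z + ∑ i, c i := by
    rw [Finset.sum_add_distrib, lyap, Finset.mul_sum]
    gcongr with i
    · exact mul_nonneg (inv_pos.2 (hθ i)).le (inner_nonneg_of_posSemidef hY.posSemidef _)
    · have := D.ρmin_le i
      unfold ρ at this
      linarith
  rw [Finset.sum_sub_distrib, ← Finset.mul_sum, ← Finset.mul_sum] at h7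
  change _ ≤ _ - D.α₁ * D.lyap z at h7
  rw [h6]
  linarith

end Design
end EventTriggered

/-! ### Runs of the closed loop: no accumulation of events, ultimate bound -/

namespace EventTriggered
namespace Design

open Filter Topology

variable {N n p : ℕ} {D : Design N n p}

lemma sum_LG_smul (w : Fin N → Vec n) (i : Fin N) :
    ∑ j, D.LG i j • w j = (D.deg i + D.g i) • w i - ∑ j, D.adj i j • w j := by
  simp only [LG, Matrix.add_apply, Matrix.sub_apply, add_smul, sub_smul, Finset.sum_add_distrib,
    Finset.sum_sub_distrib, Matrix.diagonal_apply, ite_smul, zero_smul, Finset.sum_ite_eq,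
    Finset.mem_univ, if_true]
  abel

lemma combDeriv_eq (x₀ : ℝ → Vec n) (x : Fin N → ℝ → Vec n) (w : Fin N → Vec n) (i : Fin N)
    (τ : ℝ) :
    D.combDeriv (fun j => D.combState x₀ x j τ) w i =
      (∑ j, D.adj i j • ((Matrix.toEuclideanLin D.A (x j τ)
        + Matrix.toEuclideanLin D.B (-(Matrix.toEuclideanLin D.K (w j))))
        - (Matrix.toEuclideanLin D.A (x i τ)
        + Matrix.toEuclideanLin D.B (-(Matrix.toEuclideanLin D.K (w i))))))
      + D.g i • (Matrix.toEuclideanLin D.A (x₀ τ) - (Matrix.toEuclideanLin D.A (x i τ)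
        + Matrix.toEuclideanLin D.B (-(Matrix.toEuclideanLin D.K (w i))))) := by
  simp only [combDeriv, combState, sum_LG_smul, Matrix.toLpLin_mul_same, LinearMap.comp_apply,
    map_add, map_sub, map_sum, map_smul, map_neg, smul_add, smul_sub, smul_neg,
    Finset.sum_add_distrib, Finset.sum_sub_distrib, Finset.sum_neg_distrib, ← Finset.sum_smul,
    add_smul]
  change _ + (D.deg i • _ + _ - _) = _ + _ - (D.deg i • _ + -(D.deg i • _)) + _
  simp only [deg]
  abel

variable {ν σ : Fin N → ℝ} {γ : ℝ} {x₀ : ℝ → Vec n} {x : Fin N → ℝ → Vec n}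
  {t : Fin N → ℕ → EReal} {zhat : Fin N → ℝ → Vec n}

/-- The state-dependent and the exponential term are nonnegative. This uniform floor excludes
accumulation and is the deviation required for an event. -/
lemma le_threshold (hN : 0 < N) (hθ : ∀ i, 0 < D.θ i) (hH : D.H.PosDef) (hY : D.Y.PosDef)
    (hω : 0 < D.ω) (hμ : ∀ i, 0 < D.μ i) (hν : ∀ i, 0 < ν i) (i : Fin N) (z : Vec n) (τ : ℝ) :
    D.α * D.ω * γ ≤ D.threshold ν σ γ i z τ := by
  have hα := D.α_pos hN hH
  unfold threshold
  refine mul_le_mul_of_nonneg_left ?_ (by positivity)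
  have h1 := inner_nonneg_of_posSemidef hY.posSemidef z
  have h2 := hμ i
  have h3 := inv_pos.2 (hθ i)
  have h4 := hν i
  have : 0 ≤ D.μ i * (D.θ i)⁻¹ * inner ℝ z (Matrix.toEuclideanLin D.Y z)
    + ν i * Real.exp (-σ i * τ) := by positivity
  linarith

lemma hasDerivWithinAt_lyap (hY : D.Y.PosDef) {z : Fin N → ℝ → Vec n} {z' : Fin N → Vec n}
    {s : Set ℝ} {τ : ℝ} (hz : ∀ i, HasDerivWithinAt (z i) (z' i) s τ) :
    HasDerivWithinAt (fun r => D.lyap fun i => z i r)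
      (∑ i, (D.θ i)⁻¹ * (2 * inner ℝ (z i τ) (Matrix.toEuclideanLin D.Y (z' i)))) s τ := by
  unfold lyap
  refine HasDerivWithinAt.fun_sum fun i _ => HasDerivWithinAt.const_mul _ ?_
  have h1 : HasDerivWithinAt (fun r => Matrix.toEuclideanLin D.Y (z i r))
      (Matrix.toEuclideanLin D.Y (z' i)) s τ :=
    (LinearMap.toContinuousLinearMap
      (Matrix.toEuclideanLin D.Y)).hasFDerivAt.comp_hasDerivWithinAt τ (hz i)
  have h2 := (hz i).inner ℝ h1
  rwa [D.inner_Y_comm hY (z' i), ← two_mul] at h2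

namespace IsClosedLoop

variable (hrun : D.IsClosedLoop ν σ γ x₀ x t zhat)
include hrun

lemma continuousOn_combState (i : Fin N) : ContinuousOn (D.combState x₀ x i) (Ici 0) := by
  have h0 : ContinuousOn x₀ (Ici 0) := fun τ hτ => (hrun.leader τ hτ).continuousWithinAt
  have h1 := hrun.continuousOn
  exact ContinuousOn.add
    (continuousOn_finsetSum _ fun j _ => ((h1 j).sub (h1 i)).const_smul (D.adj i j))
    ((h0.sub (h1 i)).const_smul (D.g i))

lemma hasDerivWithinAt_combState (i : Fin N) {τ : ℝ} (hτ : 0 ≤ τ) :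
    HasDerivWithinAt (D.combState x₀ x i)
      (D.combDeriv (fun j => D.combState x₀ x j τ) (fun j => zhat j τ) i) (Ici τ) τ := by
  have h0 := (hrun.leader τ hτ).mono (Ici_subset_Ici.2 hτ)
  have h1 := fun j => hrun.follower j τ hτ
  rw [combDeriv_eq]
  unfold combState
  exact (HasDerivWithinAt.fun_sum fun j _ => ((h1 j).sub (h1 i)).const_smul (D.adj i j)).add
    ((h0.sub (h1 i)).const_smul (D.g i))

lemma event_le_succ (i : Fin N) (k : ℕ) : t i k ≤ t i (k + 1) := by
  rw [hrun.next_event i k]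
  refine le_sInf ?_
  rintro _ ⟨τ, hτ, rfl⟩
  exact hτ.1.le

lemma event_monotone (i : Fin N) : Monotone (t i) :=
  monotone_nat_of_le_succ (hrun.event_le_succ i)

lemma event_nonneg (i : Fin N) (k : ℕ) : 0 ≤ t i k := by
  rw [← hrun.first_event i]
  exact hrun.event_monotone i (Nat.zero_le k)

lemma exists_coe_event {i : Fin N} {k : ℕ} (h : t i k ≠ ⊤) :
    ∃ a : ℝ, 0 ≤ a ∧ t i k = a := by
  have h0 := hrun.event_nonneg i k
  have hb : t i k ≠ ⊥ := fun hb => by simp [hb] at h0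
  refine ⟨(t i k).toReal, EReal.toReal_nonneg h0, (EReal.coe_toReal h hb).symm⟩

lemma deviation_le_threshold (hα : 0 < D.α * D.ω * γ)
    (hthr : ∀ i z τ, D.α * D.ω * γ ≤ D.threshold ν σ γ i z τ) {i : Fin N} {k : ℕ} {a τ : ℝ}
    (ha : t i k = a) (haτ : a ≤ τ) (hτ : (τ : EReal) < t i (k + 1)) :
    ‖D.combState x₀ x i a - D.combState x₀ x i τ‖ ^ 2 ≤
      D.threshold ν σ γ i (D.combState x₀ x i τ) τ := by
  rcases haτ.eq_or_lt with rfl | haτ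
  · simpa using hα.le.trans (hthr _ _ _)
  · by_contra! hlt
    rw [hrun.next_event i k] at hτ
    refine hτ.not_ge (sInf_le ⟨τ, ⟨?_, ?_⟩, rfl⟩)
    · rw [ha]; exact_mod_cast haτ
    · rw [ha]; exact hlt.le

/-- By continuity the triggering set is closed relative to `[a, ∞)`, so its infimum satisfies the
triggering inequality. It cannot be `a`, where the deviation vanishes. -/
lemma exists_next_event (hα : 0 < D.α * D.ω * γ)
    (hthr : ∀ i z τ, D.α * D.ω * γ ≤ D.threshold ν σ γ i z τ) {i : Fin N} {k : ℕ} {a : ℝ}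
    (ha0 : 0 ≤ a) (ha : t i k = a) (hk : t i (k + 1) ≠ ⊤) :
    ∃ b : ℝ, a < b ∧ t i (k + 1) = b ∧
      D.α * D.ω * γ ≤ ‖D.combState x₀ x i a - D.combState x₀ x i b‖ ^ 2 := by
  have hz := hrun.continuousOn_combState i
  set z := D.combState x₀ x i with hzdef
  obtain ⟨b, hb0, hb⟩ := hrun.exists_coe_event hk
  have hnext := hrun.next_event i k
  rw [hb, ha] at hnext
  simp only [EReal.toReal_coe, EReal.coe_lt_coe_iff] at hnext
  rw [← hzdef] at hnext
  set S : Set ℝ := {τ | a < τ ∧ D.threshold ν σ γ i (z τ) τ ≤ ‖z a - z τ‖ ^ 2} with hS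
  have hglb : IsGLB S b := by
    have := isGLB_sInf ((fun τ : ℝ => (τ : EReal)) '' S)
    rw [← hnext] at this
    constructor
    · intro τ hτ
      exact EReal.coe_le_coe_iff.1 (this.1 ⟨τ, hτ, rfl⟩)
    · intro c hc
      have h : (c : EReal) ≤ b := this.2 (by
        rintro _ ⟨τ, hτ, rfl⟩
        exact EReal.coe_le_coe_iff.2 (hc hτ))
      exact_mod_cast h
  have hne : S.Nonempty := by
    by_contra h
    rw [Set.not_nonempty_iff_eq_empty] at h
    rw [h] at hnext
    simp at hnext
  have hab : a ≤ b := hglb.2 fun τ hτ => hτ.1.le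
  have hclosed : IsClosed {τ ∈ Ici a | 0 ≤ ‖z a - z τ‖ ^ 2 - D.threshold ν σ γ i (z τ) τ} := by
    have hza : ContinuousOn z (Ici a) := hz.mono (Ici_subset_Ici.2 ha0)
    have hYz : ContinuousOn (fun τ => Matrix.toEuclideanLin D.Y (z τ)) (Ici a) :=
      (LinearMap.continuous_of_finiteDimensional (Matrix.toEuclideanLin D.Y)).comp_continuousOn hza
    have hcont : ContinuousOn
        (fun τ => ‖z a - z τ‖ ^ 2 - D.threshold ν σ γ i (z τ) τ) (Ici a) := by
      unfold threshold
      fun_prop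
    exact hcont.preimage_isClosed_of_isClosed isClosed_Ici isClosed_Ici (t := Ici 0)
  have hmem := hclosed.closure_subset_iff.2
    (fun τ (hτ : τ ∈ S) => ⟨hτ.1.le, sub_nonneg.2 hτ.2⟩) (hglb.mem_closure hne)
  have htrig := (hthr i (z b) b).trans (sub_nonneg.1 hmem.2)
  refine ⟨b, hab.lt_of_ne ?_, hb, htrig⟩
  rintro rfl
  simp at htrig
  linarith

/-- The event times of an agent do not accumulate. -/
lemma exists_lt_event (hα : 0 < D.α * D.ω * γ)
    (hthr : ∀ i z τ, D.α * D.ω * γ ≤ D.threshold ν σ γ i z τ) (i : Fin N) (T : ℝ) :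
    ∃ k, (T : EReal) < t i k := by
  by_contra! h
  have htop : ∀ k, t i k ≠ ⊤ := fun k hk => by
    have := h k
    rw [hk] at this
    simp at this
  choose a ha0 ha using fun k => hrun.exists_coe_event (htop k)
  have hmono : Monotone a := fun k l hkl => by
    have := hrun.event_monotone i hkl
    rw [ha, ha] at this
    exact_mod_cast this
  have hbdd : BddAbove (range a) := by
    refine ⟨T, ?_⟩
    rintro _ ⟨k, rfl⟩
    have := h k
    rw [ha] at this
    exact_mod_cast this
  have hlim := tendsto_atTop_ciSup hmono hbdd
  set L := ⨆ k, a k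
  have hL : 0 ≤ L := (ha0 0).trans (le_ciSup hbdd 0)
  -- Both `z (a k)` and `z (a (k + 1))` tend to `z L`, so the jumps tend to zero, against their
  -- positive lower bound.
  have hz := (hrun.continuousOn_combState i L hL).tendsto.comp
    (tendsto_nhdsWithin_iff.2 ⟨hlim, Eventually.of_forall ha0⟩)
  have hd := ((hz.sub (hz.comp (tendsto_add_atTop_nat 1))).norm).pow 2
  rw [sub_self, norm_zero, zero_pow two_ne_zero] at hd
  refine (ge_of_tendsto' hd fun k => ?_).not_gt hα
  obtain ⟨b, -, hb, hjump⟩ := hrun.exists_next_event hα hthr (ha0 k) (ha k) (htop (k + 1))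
  rw [ha (k + 1)] at hb
  have : a (k + 1) = b := by exact_mod_cast hb
  simpa [this] using hjump

/-- Every time lies in an interval between consecutive events. -/
lemma exists_current_event (hα : 0 < D.α * D.ω * γ)
    (hthr : ∀ i z τ, D.α * D.ω * γ ≤ D.threshold ν σ γ i z τ) (i : Fin N) {τ : ℝ} (hτ : 0 ≤ τ) :
    ∃ k, ∃ a : ℝ, 0 ≤ a ∧ t i k = a ∧ a ≤ τ ∧ (τ : EReal) < t i (k + 1) ∧
      zhat i τ = D.combState x₀ x i a := by
  classical
  have hex := hrun.exists_lt_event hα hthr i τ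
  obtain ⟨k, hk⟩ : ∃ k, Nat.find hex = k + 1 := by
    refine Nat.exists_eq_succ_of_ne_zero fun h0 => ?_
    have := Nat.find_spec hex
    rw [h0, hrun.first_event] at this
    exact absurd (by exact_mod_cast this) hτ.not_gt
  have h1 : (τ : EReal) < t i (k + 1) := hk ▸ Nat.find_spec hex
  have h2 : t i k ≤ τ := not_lt.1 (Nat.find_min hex (hk ▸ Nat.lt_succ_self k))
  obtain ⟨a, ha0, ha⟩ := hrun.exists_coe_event (ne_top_of_le_ne_top (EReal.coe_ne_top τ) h2)
  have h3 := hrun.held i k τ h2 h1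
  rw [ha, EReal.toReal_coe] at h3
  rw [ha] at h2
  exact ⟨k, a, ha0, ha, by exact_mod_cast h2, h1, h3⟩

/-- The Lyapunov function eventually falls below every level above `N γ / ρ_min`. -/
lemma eventually_lyap_le (hN : 0 < N) (hn : 0 < n) (hθ : ∀ i, 0 < D.θ i) (hH : D.H.PosDef)
    (hR : D.R.PosDef) (hQ : D.Q.PosDef) (hY : D.Y.PosDef) (hriccati : (-D.riccati).PosSemidef)
    (hω : 0 < D.ω) (hρ : ∀ i, 0 < D.ρ i) (hσ : ∀ i, 0 < σ i)
    (hα : 0 < D.α * D.ω * γ) (hthr : ∀ i z τ, D.α * D.ω * γ ≤ D.threshold ν σ γ i z τ)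
    {c : ℝ} (hc : N * γ < D.ρmin * c) :
    ∀ᶠ τ in atTop, D.lyap (fun i => D.combState x₀ x i τ) ≤ c := by
  have hρm := D.ρmin_pos hN hρ
  -- The gap between `Nγ/ρ_min` and `d` absorbs the decaying forcing; the gap between `d` and `c`
  -- absorbs the Grönwall transient.
  obtain ⟨d, hd, hdc⟩ : ∃ d, N * γ < D.ρmin * d ∧ d < c := by
    rw [← div_lt_iff₀' hρm] at hc
    obtain ⟨d, h1, h2⟩ := exists_between hc
    exact ⟨d, (div_lt_iff₀' hρm).1 h1, h2⟩
  have hdecay : Tendsto (fun τ => ∑ i, (ν i * Real.exp (-σ i * τ) + γ)) atTop (𝓝 (N * γ)) := by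
    have : Tendsto (fun τ => ∑ i, (ν i * Real.exp (-σ i * τ) + γ)) atTop
        (𝓝 (∑ i : Fin N, (ν i * 0 + γ))) := by
      refine tendsto_finsetSum _ fun i _ => (Tendsto.const_mul _ ?_).add_const _
      refine Real.tendsto_exp_atBot.comp ?_
      exact tendsto_id.const_mul_atTop_of_neg (neg_neg_of_pos (hσ i))
    simpa using this
  obtain ⟨T, hT0, hT⟩ : ∃ T : ℝ, 0 ≤ T ∧ ∀ τ ≥ T,
      ∑ i, (ν i * Real.exp (-σ i * τ) + γ) ≤ D.ρmin * d := by
    obtain ⟨T, hT⟩ := eventually_atTop.1 (hdecay.eventually_le_const hd)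
    exact ⟨max T 0, le_max_right _ _, fun τ hτ => hT τ ((le_max_left _ _).trans hτ)⟩
  set V : ℝ → ℝ := fun τ => D.lyap (fun i => D.combState x₀ x i τ) with hV
  have hd0 : 0 ≤ d := by
    have h1 : 0 < D.ρmin * d := lt_of_le_of_lt ?_ hd
    · exact (pos_of_mul_pos_right h1 hρm.le).le
    · have := D.α_pos hN hH
      have hγ : 0 < γ := pos_of_mul_pos_right hα (by positivity)
      positivity
  have hbound : ∀ b ≥ T, V b ≤ V T * Real.exp (-D.ρmin * (b - T)) + d := by
    intro b hb
    have hcont : ContinuousOn V (Icc T b) := by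
      have hz : ∀ i, ContinuousOn (D.combState x₀ x i) (Icc T b) := fun i =>
        (hrun.continuousOn_combState i).mono fun τ hτ => hT0.trans hτ.1
      have hYz : ∀ i, ContinuousOn
          (fun τ => Matrix.toEuclideanLin D.Y (D.combState x₀ x i τ)) (Icc T b) := fun i =>
        (LinearMap.continuous_of_finiteDimensional
          (Matrix.toEuclideanLin D.Y)).comp_continuousOn (hz i)
      exact continuousOn_finsetSum _ fun i _ =>
        continuousOn_const.mul ((hz i).inner (𝕜 := ℝ) (hYz i))
    have hderiv : ∀ τ ∈ Ico T b, HasDerivWithinAt V _ (Ici τ) τ := fun τ hτ =>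
      hasDerivWithinAt_lyap hY fun i =>
        hrun.hasDerivWithinAt_combState i (hT0.trans hτ.1)
    have hle := le_gronwallBound_of_liminf_deriv_right_le (δ := V T) (K := -D.ρmin)
      (ε := D.ρmin * d) hcont
      (fun τ hτ r hr => (hderiv τ hτ).liminf_right_slope_le hr) le_rfl (fun τ hτ => ?_) b
      (right_mem_Icc.2 hb)
    · rw [gronwallBound_of_K_ne_0 (neg_ne_zero.2 hρm.ne'), div_neg,
        mul_div_cancel_left₀ _ hρm.ne'] at hle
      refine hle.trans ?_
      have := mul_nonneg hd0 (Real.exp_pos (-D.ρmin * (b - T))).le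
      linarith
    · have hτ0 := hT0.trans hτ.1
      choose k a _ hak haτ hτk hzhat using
        fun i => hrun.exists_current_event hα hthr i hτ0
      have hdiss := D.lyap_dissipation hN hn hθ hH hR hQ hY hriccati hω
        (fun i => D.combState x₀ x i τ) (fun i => D.combState x₀ x i (a i) - D.combState x₀ x i τ)
        (fun i => ν i * Real.exp (-σ i * τ) + γ) (fun i => by
          have := hrun.deviation_le_threshold hα hthr (hak i) (haτ i) (hτk i)
          rwa [threshold, add_assoc] at this)
      -- State plus measurement error is the held sample, so the bound concerns the actual
      -- derivative.
      simp only [add_sub_cancel, ← hzhat] at hdiss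
      exact hdiss.trans (add_le_add_right (hT τ hτ.1) _)
  have hlim : Tendsto (fun b => V T * Real.exp (-D.ρmin * (b - T)) + d) atTop
      (𝓝 (V T * 0 + d)) := by
    refine (Tendsto.const_mul _ (Real.tendsto_exp_atBot.comp ?_)).add_const _
    exact (tendsto_atTop_add_const_right _ (-T) tendsto_id).const_mul_atTop_of_neg
      (neg_neg_of_pos hρm)
  rw [mul_zero, zero_add] at hlim
  filter_upwards [hlim.eventually_le_const hdc, eventually_ge_atTop T] with b h1 h2
  exact (hbound b h2).trans h1

end IsClosedLoop

end Design
end EventTriggered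

/-! ### Growth of the deviation between events -/

namespace EventTriggered
namespace Design

open Filter Topology

variable {N n p : ℕ} {D : Design N n p}

/-- `η i = ‖A‖ + (2 d i + g i) ‖B K‖`. -/
def eta (D : Design N n p) (i : Fin N) : ℝ :=
  matNorm D.A + (2 * D.deg i + D.g i) * matNorm (D.B * D.K)

lemma eta_le_etaBar (i : Fin N) : D.eta i ≤ D.etaBar :=
  le_ciSup (Set.finite_range D.eta).bddAbove i

lemma eta_pos (hA : D.A ≠ 0) (i : Fin N) : 0 < D.eta i := by
  have h1 := matNorm_pos hA
  have h2 := matNorm_nonneg (D.B * D.K)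
  have h3 := D.deg_nonneg i
  have h4 := D.g_nonneg i
  unfold eta
  positivity

/-- The own sample enters with weight `d_i + g_i` and the neighbours with total weight `d_i`; all
other weights vanish. -/
lemma norm_sum_LG_smul_le {w : Fin N → Vec n} {i : Fin N} {r : ℝ} (hi : ‖w i‖ ≤ r)
    (hw : ∀ j, D.graph.Adj j i → ‖w j‖ ≤ r) :
    ‖∑ j, D.LG i j • w j‖ ≤ (2 * D.deg i + D.g i) * r := by
  have h3 := D.deg_nonneg i
  have h4 := D.g_nonneg i
  have h1 : ‖∑ j, D.adj i j • w j‖ ≤ D.deg i * r := by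
    rw [deg, Finset.sum_mul]
    refine norm_sum_le_of_le _ fun j _ => ?_
    rw [norm_smul, Real.norm_of_nonneg (D.adj_nonneg i j)]
    by_cases hj : D.graph.Adj j i
    · exact mul_le_mul_of_nonneg_left (hw j hj) (D.adj_nonneg i j)
    · simp [D.adj_eq_zero hj]
  have h2 : ‖(D.deg i + D.g i) • w i‖ ≤ (D.deg i + D.g i) * r := by
    rw [norm_smul, Real.norm_of_nonneg (by positivity)]
    gcongr
  rw [sum_LG_smul]
  linarith [norm_sub_le ((D.deg i + D.g i) • w i) (∑ j, D.adj i j • w j)]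

/-- Writing `A z_i = A w_i - A (w_i - z_i)` leaves the deviation as the only term not given by held
samples, as Grönwall's inequality needs. -/
lemma norm_combDeriv_le {z w : Fin N → Vec n} {i : Fin N} {r : ℝ}
    (hi : ‖w i‖ ≤ r) (hw : ∀ j, D.graph.Adj j i → ‖w j‖ ≤ r) :
    ‖D.combDeriv z w i‖ ≤ matNorm D.A * ‖w i - z i‖ + D.eta i * r := by
  have h1 := norm_sum_LG_smul_le (D := D) hi hw
  have h2 := (norm_toEuclideanLin_le (D.B * D.K) (∑ j, D.LG i j • w j)).trans
    (mul_le_mul_of_nonneg_left h1 (matNorm_nonneg _))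
  have h3 := norm_toEuclideanLin_le D.A (w i - z i)
  have h4 := (norm_toEuclideanLin_le D.A (w i)).trans
    (mul_le_mul_of_nonneg_left hi (matNorm_nonneg _))
  have h5 : D.combDeriv z w i = Matrix.toEuclideanLin D.A (w i)
      - Matrix.toEuclideanLin D.A (w i - z i)
      + Matrix.toEuclideanLin (D.B * D.K) (∑ j, D.LG i j • w j) := by
    rw [combDeriv, map_sub]
    abel
  rw [h5, eta]
  refine (norm_add_le _ _).trans ?_
  have := norm_sub_le (Matrix.toEuclideanLin D.A (w i)) (Matrix.toEuclideanLin D.A (w i - z i))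
  linarith

variable {ν σ : Fin N → ℝ} {γ : ℝ} {x₀ : ℝ → Vec n} {x : Fin N → ℝ → Vec n}
  {t : Fin N → ℕ → EReal} {zhat : Fin N → ℝ → Vec n}

namespace IsClosedLoop

/-- If the measurements of agent `i` and its neighbours are bounded by `r` between two events of
agent `i`, then the deviation at the second event is bounded in terms of the interval length. -/
lemma norm_jump_le (hrun : D.IsClosedLoop ν σ γ x₀ x t zhat) (hA : D.A ≠ 0) {i : Fin N} {k : ℕ}
    {a b r : ℝ} (ha0 : 0 ≤ a) (hab : a < b) (ha : t i k = a) (hb : t i (k + 1) = b)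
    (hi : ∀ τ ∈ Ico a b, ‖zhat i τ‖ ≤ r)
    (hw : ∀ τ ∈ Ico a b, ∀ j, D.graph.Adj j i → ‖zhat j τ‖ ≤ r) :
    ‖D.combState x₀ x i a - D.combState x₀ x i b‖ ≤
      D.eta i * r / matNorm D.A * (Real.exp (matNorm D.A * (b - a)) - 1) := by
  have hAn := matNorm_pos hA
  have hheld : ∀ τ ∈ Ico a b, zhat i τ = D.combState x₀ x i a := fun τ hτ => by
    have := hrun.held i k τ (by rw [ha]; exact_mod_cast hτ.1) (by rw [hb]; exact_mod_cast hτ.2)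
    rwa [ha, EReal.toReal_coe] at this
  have h := norm_le_gronwallBound_of_norm_deriv_right_le (δ := 0) (K := matNorm D.A)
    (ε := D.eta i * r) (f := fun τ => D.combState x₀ x i a - D.combState x₀ x i τ)
    (f' := fun τ => -D.combDeriv (fun j => D.combState x₀ x j τ) (fun j => zhat j τ) i)
    (a := a) (b := b) ?_ ?_ (by simp) ?_ b (right_mem_Icc.2 hab.le)
  · simpa only [gronwallBound_of_K_ne_0 hAn.ne', zero_mul, zero_add] using h
  · exact continuousOn_const.sub
      ((hrun.continuousOn_combState i).mono fun τ hτ => ha0.trans hτ.1)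
  · intro τ hτ
    exact (hrun.hasDerivWithinAt_combState i (ha0.trans hτ.1)).const_sub _
  · intro τ hτ
    rw [norm_neg, ← hheld τ hτ]
    exact norm_combDeriv_le (hi τ hτ) (hw τ hτ)

end IsClosedLoop

/-- The length of an interval after which a deviation of size `√(α ω γ)` can be reached. -/
lemma interEventBound_le_of_deviation (hN : 0 < N) (hA : D.A ≠ 0) (hα : 0 < D.α) (hω : 0 < D.ω)
    (hγ : 0 < γ) {E : ℝ} (hE : E = D.thetaUnder * lamMin D.Y * D.ρmin) (hE0 : 0 < E)
    {δ h r : ℝ} (hδ : 0 < δ) (hr : r = (1 + δ) * √(N * γ / E)) {i : Fin N}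
    (hdev : √(D.α * D.ω * γ) ≤
      D.eta i * r / matNorm D.A * (Real.exp (matNorm D.A * h) - 1)) :
    D.interEventBound δ ≤ h := by
  have hAn := matNorm_pos hA
  have hη := D.eta_pos hA i
  have hηb := hη.trans_le (D.eta_le_etaBar i)
  have hN' : (0 : ℝ) < N := by exact_mod_cast hN
  have hr0 : 0 < r := by rw [hr]; positivity
  -- This identity removes `γ` from the ratio of required deviation to sample bound.
  have hsq : √(D.α * D.ω * E) * √(N * γ / E) = √(D.α * D.ω * γ) * √N := by
    rw [← Real.sqrt_mul (by positivity), ← Real.sqrt_mul (by positivity)]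
    congr 1
    field_simp
  -- The sign of `h` is not assumed; it follows from `hdev` and is needed to enlarge `η_i` to `η̄`.
  have hexp : 0 ≤ Real.exp (matNorm D.A * h) - 1 := by
    by_contra! hneg
    have := Real.sqrt_nonneg (D.α * D.ω * γ)
    have := mul_neg_of_pos_of_neg (by positivity : 0 < D.eta i * r / matNorm D.A) hneg
    linarith
  have hdev' : √(D.α * D.ω * γ) ≤
      D.etaBar * r / matNorm D.A * (Real.exp (matNorm D.A * h) - 1) := by
    refine hdev.trans ?_
    have := D.eta_le_etaBar i
    gcongr
  have hratio : √(D.α * D.ω * E) / ((1 + δ) * √N) = √(D.α * D.ω * γ) / r := by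
    rw [hr, div_eq_div_iff (by positivity) (by positivity)]
    linear_combination (1 + δ) * hsq
  have hkey : 1 + matNorm D.A * √(D.α * D.ω * E) / (D.etaBar * (1 + δ) * √N) ≤
      Real.exp (matNorm D.A * h) := by
    have h1 : matNorm D.A * √(D.α * D.ω * E) / (D.etaBar * (1 + δ) * √N) =
        matNorm D.A / D.etaBar * (√(D.α * D.ω * E) / ((1 + δ) * √N)) := by
      rw [div_mul_div_comm, mul_assoc D.etaBar]
    rw [h1, hratio, div_mul_div_comm, ← le_sub_iff_add_le', div_le_iff₀ (by positivity)]
    have h2 := mul_le_mul_of_nonneg_left hdev' hAn.le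
    have h3 : matNorm D.A * (D.etaBar * r / matNorm D.A * (Real.exp (matNorm D.A * h) - 1)) =
        (Real.exp (matNorm D.A * h) - 1) * (D.etaBar * r) := by
      field_simp
    rwa [h3] at h2
  have hE' : D.α * D.ω * D.thetaUnder * lamMin D.Y * D.ρmin = D.α * D.ω * E := by
    rw [hE]; ring
  rw [interEventBound, hE', one_div_mul_eq_div, div_le_iff₀' hAn]
  rw [← Real.log_exp (matNorm D.A * h)]
  exact Real.log_le_log (by positivity) hkey

end Design
end EventTriggered
end

/-! ### The asymptotic bound on inter-event intervals -/

theorem corollary1 {N n p : ℕ} (D : EventTriggered.Design N n p)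
    -- the communication graph
    (hloop : ∀ i, ¬ D.graph.Adj i i)
    (htree : ∃ r ∈ D.pinned, EventTriggered.HasSpanningTreeRootedAt D.graph r)
    -- the choice of `Θ`
    (hθ : ∀ i, 0 < D.θ i) (hH : D.H.PosDef)
    -- the matrices of the Riccati inequality
    (hA : D.A ≠ 0) (hR : D.R.PosDef) (hQ : D.Q.PosDef) (hY : D.Y.PosDef)
    (hriccati : (-D.riccati).PosSemidef)
    -- the parameters of the triggering rule
    (hω : 0 < D.ω) (hμ : ∀ i, 0 < D.μ i) (hρ : ∀ i, 0 < D.ρ i)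
    (ν σ : Fin N → ℝ) (hν : ∀ i, 0 < ν i) (hσ : ∀ i, 0 < σ i ∧ σ i < D.ρmin)
    (γ : ℝ) (hγ : 0 < γ)
    -- a run of the closed loop
    (x₀ : ℝ → EventTriggered.Vec n) (x : Fin N → ℝ → EventTriggered.Vec n)
    (t : Fin N → ℕ → EReal) (zhat : Fin N → ℝ → EventTriggered.Vec n)
    (hrun : D.IsClosedLoop ν σ γ x₀ x t zhat) :
    -- the event times of an agent do not accumulate at a finite time
    (∀ i (T : ℝ), ∃ k, (T : EReal) < t i k) ∧
    -- asymptotic lower bound on the inter-event intervals of every agent whose neighbours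
    -- have infinite sequences of events
    ∀ δ : ℝ, 0 < δ → ∃ tδ : ℝ, ∀ i, (∀ j, D.graph.Adj j i → ∀ k, t j k ≠ ⊤) →
      ∀ k, (tδ : EReal) < t i k →
        t i k + (D.interEventBound δ : EReal) ≤ t i (k + 1) := by
  have hN : 0 < N := by
    obtain ⟨r, -⟩ := htree
    exact r.pos
  have hn : 0 < n := by
    by_contra h
    have h0 : n = 0 := by omega
    subst h0
    exact hA (Subsingleton.elim _ _)
  have hα := D.α_pos hN hH
  have hαγ : 0 < D.α * D.ω * γ := by positivity
  have hthr := fun i z τ =>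
    EventTriggered.Design.le_threshold (γ := γ) (σ := σ) hN hθ hH hY hω hμ hν i z τ
  have hex := hrun.exists_lt_event hαγ hthr
  refine ⟨hex, fun δ hδ => ?_⟩
  have hρm := D.ρmin_pos hN hρ
  have hθu := D.thetaUnder_pos hN hθ
  have hlY := EventTriggered.lamMin_pos hn hY
  have hN' : (0 : ℝ) < N := by exact_mod_cast hN
  set E := D.thetaUnder * EventTriggered.lamMin D.Y * D.ρmin with hE
  have hE0 : 0 < E := by positivity
  set r := (1 + δ) * √(N * γ / E) with hr
  have hr0 : 0 < r := by positivity
  -- all combinational states are eventually bounded by `r`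
  obtain ⟨T, hT⟩ : ∃ T : ℝ, ∀ τ ≥ T, ∀ i, ‖D.combState x₀ x i τ‖ ≤ r := by
    have hc : N * γ < D.ρmin * (D.thetaUnder * EventTriggered.lamMin D.Y * r ^ 2) := by
      have h1 : D.ρmin * (D.thetaUnder * EventTriggered.lamMin D.Y * r ^ 2) =
          (1 + δ) ^ 2 * (N * γ) := by
        rw [hr, mul_pow, Real.sq_sqrt (by positivity), hE]
        field_simp
      have h2 : 0 < (N : ℝ) * γ := by positivity
      rw [h1]
      exact lt_mul_of_one_lt_left h2 (one_lt_pow₀ (by linarith) two_ne_zero)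
    obtain ⟨T, hT⟩ := Filter.eventually_atTop.1 (hrun.eventually_lyap_le hN hn hθ hH hR hQ hY
      hriccati hω hρ (fun i => (hσ i).1) hαγ hthr hc)
    refine ⟨T, fun τ hτ i => ?_⟩
    have h1 := (D.sum_norm_sq_le_lyap hn hθ hY fun i => D.combState x₀ x i τ).trans (hT τ hτ)
    have h2 := le_of_mul_le_mul_left h1 (by positivity)
    have h3 := (Finset.single_le_sum (f := fun i => ‖D.combState x₀ x i τ‖ ^ 2)
      (fun i _ => sq_nonneg _) (Finset.mem_univ i)).trans h2
    exact le_of_sq_le_sq h3 hr0.le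
  -- the agents with infinitely many events have sampled after `T`
  choose m hm using fun j => hex j T
  -- If `t j (m j) = ⊤`, then `toReal` gives the harmless value 0; for neighbours of an agent
  -- covered by the bound this event is finite.
  obtain ⟨tδ, htδ⟩ : ∃ tδ : ℝ, ∀ j, max T (t j (m j)).toReal ≤ tδ := by
    obtain ⟨tδ, h⟩ := (Set.finite_range fun j => max T (t j (m j)).toReal).bddAbove
    exact ⟨tδ, fun j => h ⟨j, rfl⟩⟩
  refine ⟨tδ, fun i hinf k hk => ?_⟩
  by_cases hk1 : t i (k + 1) = ⊤
  · rw [hk1]; exact le_top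
  obtain ⟨a, ha0, ha⟩ := hrun.exists_coe_event
    (ne_top_of_le_ne_top hk1 (hrun.event_le_succ i k))
  obtain ⟨b, hab, hb, hjump⟩ := hrun.exists_next_event hαγ hthr ha0 ha hk1
  have hka : tδ < a := by rw [ha] at hk; exact_mod_cast hk
  have hTa : T ≤ a := ((le_max_left _ _).trans (htδ i)).trans hka.le
  have hdev := hrun.norm_jump_le hA ha0 hab ha hb (r := r) (fun τ hτ => ?_) (fun τ hτ j hj => ?_)
  · have hle : D.interEventBound δ ≤ b - a :=
      D.interEventBound_le_of_deviation hN hA hα hω hγ hE hE0 hδ hr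
        (((Real.sqrt_le_left (norm_nonneg _)).2 hjump).trans hdev)
    rw [ha, hb, ← EReal.coe_add, EReal.coe_le_coe_iff]
    linarith
  · have := hrun.held i k τ (by rw [ha]; exact_mod_cast hτ.1) (by rw [hb]; exact_mod_cast hτ.2)
    rw [this, ha, EReal.toReal_coe]
    exact hT a hTa i
  · obtain ⟨l, c, hc0, hc, hcτ, hτc, hz⟩ :=
      hrun.exists_current_event hαγ hthr j (ha0.trans hτ.1)
    rw [hz]
    refine hT c ?_ j
    -- Otherwise `t j (l + 1) ≤ t j (m j) ≤ tδ < a ≤ τ`, although `τ` precedes event `l + 1`. Hence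
    -- the neighbour's held sample was taken after `T`.
    have hml : m j ≤ l := by
      by_contra! hlt
      obtain ⟨e, -, he⟩ := hrun.exists_coe_event (hinf j hj (m j))
      have h1 := hτc.trans_le (hrun.event_monotone j (Nat.succ_le_of_lt hlt))
      have h2 := (le_max_right _ _).trans (htδ j)
      rw [he, EReal.toReal_coe] at h2
      rw [he, EReal.coe_lt_coe_iff] at h1
      linarith [hτ.1]
    have h3 := (hm j).trans_le (hrun.event_monotone j hml)
    rw [hc, EReal.coe_lt_coe_iff] at h3
    exact h3.le
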